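/- **Setting.** Let $\mathcal X$ be a finite set of variables, each $x\in\mathcal X$ taking values in a finite set $\mathcal V x$; for $S\subseteq\mathcal X$ put $\mathcal V S=\prod_{x\in S}\mathcal V x$, and let $\Delta\Omega$ be the set of probability distributions on a finite set $\Omega$. A *PDG* $\mathfrak M=(\mathcal X,\mathcal A,\mathbb P,\boldsymbol\alpha,\boldsymbol\beta)$ consists of a finite set $\mathcal A$ of arcs, each $a\in\mathcal A$ having a source set $S_a\subseteq\mathcal X$, a target set $T_a\subseteq\mathcal X$, a conditional distribution $p_a(T_a\mid S_a)$, i.e. a map $\mathcal V S_a\to\Delta\mathcal V T_a$, and weights $\alpha_a\in\mathbb R$ and $\beta_a\in\mathbb R\cup\{\infty\}$. For $\mu\in\Delta\mathcal V\mathcal X$ put $$\mathit{OInc}_{\mathfrak M}(\mu)=\sum_{a\in\mathcal A}\beta_a\,D\big(\mu(T_a,S_a)\,\big\|\,p_a(T_a\mid S_a)\,\mu(S_a)\big),\qquad \mathit{SInc}_{\mathfrak M}(\mu)=\sum_{a\in\mathcal A}\alpha_a\,\mathrm H_\mu(T_a\mid S_a)-\mathrm H(\mu),$$ where $D$ is relative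 entropy, $\mathrm H$ is (conditional) Shannon entropy, $0\cdot\infty=0$, and a sum that contains a term $-\infty$ is $-\infty$. For $0\le\gamma<\infty$ let $[\![\mathfrak M]\!]_\gamma(\mu)=\mathit{OInc}_{\mathfrak M}(\mu)+\gamma\,\mathit{SInc}_{\mathfrak M}(\mu)$, and let $[\![\mathfrak M]\!]_\infty(\mu)=\mathit{SInc}_{\mathfrak M}(\mu)$. The *$\gamma$-semantics* $[\![\mathfrak M]\!]^*_\gamma$ is the set of minimizers of $[\![\mathfrak M]\!]_\gamma$ over $\Delta\mathcal V\mathcal X$, and the *$\gamma$-inconsistency* is $\langle\!\langle\mathfrak M\rangle\!\rangle_\gamma=\inf_\mu[\![\mathfrak M]\!]_\gamma(\mu)$. A *tree decomposition* of the hypergraph of $\mathfrak M$ is a tree $(\mathcal C,\mathcal T)$ whose vertices $C\in\mathcal C$ (*clusters*) are subsets of $\mathcal X$ such that every $x\in\mathcal X$ belongs to some cluster, every set $S_a\cup T_a$ $(a\in\mathcal A)$ is contained in some cluster, and every cluster on the path in $\mathcal T$ from $C_1$ to $C_2$ contains $C_1\cap C_2$. A *clique tree* over $(\mathcal C,\mathcal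 T)$ is a collection $\boldsymbol\mu=\{\mu_C\in\Delta\mathcal V C\}_{C\in\mathcal C}$; it is *calibrated* if $\mu_C(C\cap D)=\mu_D(C\cap D)$ for every edge $C-D$ of $\mathcal T$, and then $$\Pr\nolimits_{\boldsymbol\mu}(\mathcal X)=\prod_{C\in\mathcal C}\mu_C(C)\Big/\prod_{(C-D)\in\mathcal T}\mu_C(C\cap D)\qquad(\text{with }0/0=0).$$ **Corollary.** Let $\mathfrak M$ be a PDG, let $(\mathcal C,\mathcal T)$ be a tree decomposition of its hypergraph, let $\gamma\in(0,\infty]$, and suppose that the $\gamma$-inconsistency $\langle\!\langle\mathfrak M\rangle\!\rangle_\gamma$ is finite (neither $+\infty$ nor $-\infty$). Then for every $\mu\in[\![\mathfrak M]\!]^*_\gamma$ there is a calibrated clique tree $\boldsymbol\mu$ over $(\mathcal C,\mathcal T)$ such that $\Pr_{\boldsymbol\mu}=\mu$. -/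

import Mathlib

open scoped ENNReal

/-! ### Joint settings, marginals, entropy, relative entropy (finite spaces)

`X` is the finite set of variables and `Val x` the finite set of values of the variable `x`.
Probability distributions on a finite set `Ω` are the elements of `stdSimplex ℝ Ω`. -/

/-- Joint settings of all the variables. -/
abbrev Joint {X : Type*} (Val : X → Type*) := (x : X) → Val x

/-- Joint settings of the variables in `S`. -/
abbrev Setting {X : Type*} (Val : X → Type*) (S : Finset X) := (x : S) → Val x

/-- Shannon entropy (natural logarithm, `0 log 0 = 0`). -/
noncomputable def shannonEntropy {Ω : Type*} [Fintype Ω] (μ : stdSimplex ℝ Ω) : ℝ :=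
  ∑ ω, Real.negMulLog (μ ω)

/-- Relative entropy `∑ ω, μ ω * log (μ ω / ν ω)`, equal to `+∞` unless `μ` vanishes wherever
`ν` does. -/
noncomputable def relEntropy {Ω : Type*} [Fintype Ω] (μ : stdSimplex ℝ Ω) (ν : Ω → ℝ) : EReal :=
  open Classical in
  if ∀ ω, ν ω = 0 → μ ω = 0 then ((∑ ω, μ ω * Real.log (μ ω / ν ω) : ℝ) : EReal) else ⊤

section Marginals

variable {X : Type*} [Fintype X] [DecidableEq X] {Val : X → Type*} [∀ x, Fintype (Val x)]

/-- The marginal `μ(S)` of a joint distribution. -/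
noncomputable def marginal (μ : stdSimplex ℝ (Joint Val)) (S : Finset X) :
    stdSimplex ℝ (Setting Val S) :=
  stdSimplex.map S.restrict μ

/-- The marginal `μ(T, S)`, as a distribution of the pair (setting of `T`, setting of `S`).
The sets `T` and `S` may overlap. -/
noncomputable def pairMarginal (μ : stdSimplex ℝ (Joint Val)) (T S : Finset X) :
    stdSimplex ℝ (Setting Val T × Setting Val S) :=
  stdSimplex.map (fun w => (T.restrict w, S.restrict w)) μ

/-- Conditional entropy `H_μ(T | S) = E_μ [log (1 / μ(T | S))]`, with
`μ(t | s) = μ(t, s) / μ(s)`. -/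
noncomputable def condEntropy (μ : stdSimplex ℝ (Joint Val)) (T S : Finset X) : ℝ :=
  ∑ ts : Setting Val T × Setting Val S,
    pairMarginal μ T S ts * Real.log (1 / (pairMarginal μ T S ts / marginal μ S ts.2))

end Marginals

/-! ### Probabilistic dependency graphs -/

/-- A PDG over the variables `X` with arcs `A`: a directed hypergraph whose arcs carry a cpd
`p_a (T_a | S_a)`, a weight `α_a ∈ ℝ` and a weight `β_a ∈ ℝ ∪ {∞}`. -/
structure PDG (X : Type*) [Fintype X] [DecidableEq X] (Val : X → Type*) [∀ x, Fintype (Val x)]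
    (A : Type*) where
  src : A → Finset X
  tgt : A → Finset X
  cpd : (a : A) → Setting Val (src a) → stdSimplex ℝ (Setting Val (tgt a))
  α : A → ℝ
  β : A → EReal
  β_ne_bot : ∀ a, β a ≠ ⊥

namespace PDG

variable {X : Type*} [Fintype X] [DecidableEq X] {Val : X → Type*} [∀ x, Fintype (Val x)]
  {A : Type*} [Fintype A]

/-- The hyperedge underlying an arc: its sources together with its targets. -/
def hyperedge (M : PDG X Val A) (a : A) : Finset X := M.src a ∪ M.tgt a

/-- Observational incompatibility
`∑ a, β_a * D(μ(T_a, S_a) ‖ p_a(T_a | S_a) μ(S_a))`, with `0 * ∞ = 0`. -/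
noncomputable def oInc (M : PDG X Val A) (μ : stdSimplex ℝ (Joint Val)) : EReal :=
  ∑ a, M.β a * relEntropy (pairMarginal μ (M.tgt a) (M.src a))
    (fun ts => M.cpd a ts.2 ts.1 * marginal μ (M.src a) ts.2)

/-- Structural incompatibility `(∑ a, α_a * H_μ(T_a | S_a)) - H(μ)`. -/
noncomputable def sInc (M : PDG X Val A) (μ : stdSimplex ℝ (Joint Val)) : ℝ :=
  (∑ a, M.α a * condEntropy μ (M.tgt a) (M.src a)) - shannonEntropy μ

/-- The scoring function `⟦M⟧_γ = OInc + γ SInc` for `γ ∈ [0, ∞)`. It is a positive multiple of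
`(1 - g) OInc + g SInc` with `γ = g / (1 - g)`; the value `γ = ∞` corresponds to `g = 1`, where
this convex combination is `SInc`. -/
noncomputable def score (M : PDG X Val A) (γ : ℝ≥0∞) (μ : stdSimplex ℝ (Joint Val)) : EReal :=
  open Classical in
  if γ = ⊤ then (M.sInc μ : EReal) else M.oInc μ + ((γ.toReal * M.sInc μ : ℝ) : EReal)

/-- The `γ`-semantics `⟦M⟧*_γ`: the distributions minimizing the scoring function. -/
def semantics (M : PDG X Val A) (γ : ℝ≥0∞) : Set (stdSimplex ℝ (Joint Val)) :=
  {μ | ∀ ν, M.score γ μ ≤ M.score γ ν}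

/-- The `γ`-inconsistency: the infimum of the scoring function. -/
noncomputable def inconsistency (M : PDG X Val A) (γ : ℝ≥0∞) : EReal :=
  ⨅ μ, M.score γ μ

end PDG

/-! ### Tree decompositions and clique trees -/

/-- `(𝒞, 𝒯)` is a tree decomposition of the hypergraph with vertex set `X` and hyperedges
`E a`, `a : A`. -/
structure IsTreeDecomposition {X A : Type*} [DecidableEq X] (E : A → Finset X)
    (𝒞 : Finset (Finset X)) (𝒯 : SimpleGraph 𝒞) : Prop where
  isTree : 𝒯.IsTree
  vertex_mem : ∀ x : X, ∃ C ∈ 𝒞, x ∈ C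
  hyperedge_subset : ∀ a : A, ∃ C ∈ 𝒞, E a ⊆ C
  inter_subset : ∀ (C₁ C₂ : 𝒞) (p : 𝒯.Walk C₁ C₂), p.IsPath →
    ∀ D ∈ p.support, (C₁ : Finset X) ∩ C₂ ⊆ D

section CliqueTrees

variable {X : Type*} [DecidableEq X]

/-- A clique tree over the clusters `𝒞`: a distribution `μ_C` on the settings of each
cluster `C`. -/
abbrev CliqueTree (Val : X → Type*) [∀ x, Fintype (Val x)] (𝒞 : Finset (Finset X)) :=
  (C : 𝒞) → stdSimplex ℝ (Setting Val (C : Finset X))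

variable {Val : X → Type*} [∀ x, Fintype (Val x)] {𝒞 : Finset (Finset X)}

namespace CliqueTree

/-- The marginal `μ_C(S)` on a set `S ⊆ C` of the distribution of the cluster `C`. -/
noncomputable def clusterMarginal (ν : CliqueTree Val 𝒞) (C : 𝒞) (S : Finset X)
    (h : S ⊆ (C : Finset X)) : stdSimplex ℝ (Setting Val S) :=
  stdSimplex.map (Finset.restrict₂ h) (ν C)

/-- Neighbouring clusters have the same marginal on the variables that they share. -/
def IsCalibrated (ν : CliqueTree Val 𝒞) (𝒯 : SimpleGraph 𝒞) : Prop :=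
  ∀ C D : 𝒞, 𝒯.Adj C D →
    ν.clusterMarginal C ((C : Finset X) ∩ D) Finset.inter_subset_left =
      ν.clusterMarginal D ((C : Finset X) ∩ D) Finset.inter_subset_right

/-- `μ_C(C ∩ D)` at the joint setting `w`. -/
noncomputable def sepProb (ν : CliqueTree Val 𝒞) (C D : 𝒞) (w : Joint Val) : ℝ :=
  ν.clusterMarginal C ((C : Finset X) ∩ D) Finset.inter_subset_left (Finset.restrict _ w)

/-- `μ_C(C ∩ D)` at the joint setting `w`, for the edge `e = {C, D}`. The endpoint `C` of `e` is
an arbitrary one; for a calibrated clique tree it does not matter which one is taken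
(`sepFactor_mk`). -/
noncomputable def sepFactor (ν : CliqueTree Val 𝒞) (e : Sym2 𝒞) (w : Joint Val) : ℝ :=
  ν.sepProb e.out.1 e.out.2 w

theorem sepProb_comm {ν : CliqueTree Val 𝒞} {𝒯 : SimpleGraph 𝒞} (hν : ν.IsCalibrated 𝒯)
    {C D : 𝒞} (h : 𝒯.Adj C D) (w : Joint Val) : ν.sepProb D C w = ν.sepProb C D w := by
  have key : ∀ (B : 𝒞) (S S' : Finset X) (hS : S ⊆ (B : Finset X)) (hS' : S' ⊆ (B : Finset X)),
      S = S' → ν.clusterMarginal B S hS (S.restrict w) =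
        ν.clusterMarginal B S' hS' (S'.restrict w) := by
    rintro B S S' hS hS' rfl
    rfl
  unfold sepProb
  rw [hν _ _ h]
  exact key _ _ _ _ _ (Finset.inter_comm _ _)

theorem sepFactor_mk {ν : CliqueTree Val 𝒞} {𝒯 : SimpleGraph 𝒞} (hν : ν.IsCalibrated 𝒯)
    {C D : 𝒞} (h : 𝒯.Adj C D) (w : Joint Val) :
    ν.sepFactor s(C, D) w = ν.sepProb C D w := by
  have hout : s((Quot.out s(C, D)).1, (Quot.out s(C, D)).2) = s(C, D) :=
    Quot.out_eq s(C, D)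
  unfold sepFactor
  rcases Sym2.eq_iff.1 hout with ⟨h1, h2⟩ | ⟨h1, h2⟩
  · rw [h1, h2]
  · rw [h1, h2]
    exact sepProb_comm hν h w

/-- The function `Pr_ν(w) = ∏_C ν_C(w_C) / ∏_{C - D} ν_C(w_{C ∩ D})`, with `0 / 0 = 0`; the
product in the denominator is over the edges of `𝒯`. -/
noncomputable def pr (ν : CliqueTree Val 𝒞) (𝒯 : SimpleGraph 𝒞) [DecidableRel 𝒯.Adj]
    (w : Joint Val) : ℝ :=
  (∏ C : 𝒞, ν C ((C : Finset X).restrict w)) / ∏ e ∈ 𝒯.edgeFinset, ν.sepFactor e w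

end CliqueTree

end CliqueTrees

/-! The clique tree is formed by the marginals of `μ` itself, so calibration is automatic; the
content is the product formula. Let `U` and `V` cover the variables, with every hyperedge inside one
of them. The conditional product `q` of the marginals of `μ` on `U` and `V` has the same marginals
on hyperedges as `μ`, hence the same `OInc` and the same conditional entropies; the score can change
only through the term `-γ H`. Minimality of `μ` gives `H(q) ≤ H(μ)`, and Gibbs' inequality with its
equality case forces `μ = q` (`eq_condProd_of_shannonEntropy_le`,
`PDG.factorizes_of_mem_semantics`).

Each tree edge yields such a cover, meeting within the separator (`IsTreeDecomposition.exists_cut`).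
Building the tree leaf by leaf and factorizing at each new edge gives the product formula
(`IsTreeDecomposition.pr_marginalCliqueTree`). -/

/-! ### Marginals as sums over joint settings; conditional independence -/

namespace JointSum

variable {X : Type*} [Fintype X] [DecidableEq X] {Val : X → Type*} [∀ x, Fintype (Val x)]

open Classical in
/-- The sum of `f` over the joint settings that agree with `w` on `S`. -/
noncomputable def sumAgree (f : Joint Val → ℝ) (S : Finset X) (w : Joint Val) : ℝ :=
  ∑ v, if ∀ x ∈ S, v x = w x then f v else 0

theorem sumAgree_congr (f : Joint Val → ℝ) (S : Finset X) {v w : Joint Val}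
    (h : ∀ x ∈ S, v x = w x) : sumAgree f S v = sumAgree f S w := by
  have hu : ∀ u : Joint Val, (∀ x ∈ S, u x = v x) ↔ ∀ x ∈ S, u x = w x := fun u =>
    forall₂_congr fun x hx => by rw [h x hx]
  refine Finset.sum_congr rfl fun u _ => ?_
  by_cases H : ∀ x ∈ S, u x = v x
  · rw [if_pos H, if_pos ((hu u).1 H)]
  · rw [if_neg H, if_neg fun H' => H ((hu u).2 H')]

theorem sumAgree_univ (f : Joint Val → ℝ) (w : Joint Val) :
    sumAgree f Finset.univ w = f w := by
  classical
  simp [sumAgree, ← funext_iff]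

theorem sumAgree_empty (f : Joint Val → ℝ) (w : Joint Val) :
    sumAgree f ∅ w = ∑ v, f v := by
  simp [sumAgree]

theorem sumAgree_nonneg {f : Joint Val → ℝ} (hf : ∀ v, 0 ≤ f v) (S : Finset X)
    (w : Joint Val) : 0 ≤ sumAgree f S w :=
  Finset.sum_nonneg fun v _ => by split_ifs <;> simp [hf v]

theorem sumAgree_mono {f : Joint Val → ℝ} (hf : ∀ v, 0 ≤ f v) {S T : Finset X} (h : S ⊆ T)
    (w : Joint Val) : sumAgree f T w ≤ sumAgree f S w := by
  refine Finset.sum_le_sum fun v _ => ?_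
  by_cases hT : ∀ x ∈ T, v x = w x
  · rw [if_pos hT, if_pos fun x hx => hT x (h hx)]
  · rw [if_neg hT]
    split_ifs <;> simp [hf v]

/-- A factor that depends only on the variables in `S` can be taken out of a sum over the joint
settings that agree on `S`. -/
theorem sumAgree_mul_left {g : Joint Val → ℝ} {S : Finset X}
    (hg : ∀ v w : Joint Val, (∀ x ∈ S, v x = w x) → g v = g w) (f : Joint Val → ℝ)
    (w : Joint Val) : sumAgree (fun v => g v * f v) S w = g w * sumAgree f S w := by
  unfold sumAgree
  rw [Finset.mul_sum]
  refine Finset.sum_congr rfl fun v _ => ?_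
  by_cases h : ∀ x ∈ S, v x = w x
  · simp only [if_pos h, hg v w h]
  · rw [if_neg h, if_neg h, mul_zero]

/-- After exchanging the sums, a setting `u` is counted once for each `v` that agrees with `w` on
`S` and with `u` on `T`. As `S` and `T` cover all variables, there is at most one such `v`, and
there is one exactly when `u` and `w` agree on `S ∩ T`. -/
theorem sumAgree_sumAgree (f : Joint Val → ℝ) {S T : Finset X} (h : S ∪ T = Finset.univ)
    (w : Joint Val) : sumAgree (sumAgree f T) S w = sumAgree f (S ∩ T) w := by
  classical
  have key : ∀ u : Joint Val,
      (∑ v : Joint Val, if ∀ x ∈ S, v x = w x then (if ∀ x ∈ T, u x = v x then f u else 0) else 0)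
        = if ∀ x ∈ S ∩ T, u x = w x then f u else 0 := by
    intro u
    have hST : ∀ x, x ∉ S → x ∈ T := fun x hx =>
      (Finset.mem_union.1 (h ▸ Finset.mem_univ x)).resolve_left hx
    rw [Finset.sum_eq_single (fun x => if x ∈ S then w x else u x)]
    · rw [if_pos fun x hx => if_pos hx]
      refine if_congr ⟨fun H x hx => ?_, fun H x hx => ?_⟩ rfl rfl
      · rw [Finset.mem_inter] at hx
        simpa [hx.1] using H x hx.2
      · by_cases hS : x ∈ S
        · simpa [hS] using H x (Finset.mem_inter.2 ⟨hS, hx⟩)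
        · simp [hS]
    · intro v _ hv
      by_cases h1 : ∀ x ∈ S, v x = w x
      · rw [if_pos h1]
        refine if_neg fun h2 => hv (funext fun x => ?_)
        by_cases hS : x ∈ S
        · simp [hS, h1 x hS]
        · simp [hS, h2 x (hST x hS)]
      · rw [if_neg h1]
    · simp
  calc sumAgree (sumAgree f T) S w
      = ∑ v : Joint Val, ∑ u : Joint Val,
          if ∀ x ∈ S, v x = w x then (if ∀ x ∈ T, u x = v x then f u else 0) else 0 := by
        refine Finset.sum_congr rfl fun v _ => ?_
        split_ifs with hv
        · simp [sumAgree]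
        · simp
    _ = sumAgree f (S ∩ T) w := by
        rw [Finset.sum_comm]
        exact Finset.sum_congr rfl fun u _ => by convert key u

/-- `f` factorizes over `A` and `B`: under the distribution `f` the variables in `A` and those in
`B` are independent given the variables in `A ∩ B`. -/
def Factorizes (f : Joint Val → ℝ) (A B : Finset X) : Prop :=
  ∀ w, sumAgree f (A ∪ B) w * sumAgree f (A ∩ B) w = sumAgree f A w * sumAgree f B w

theorem Factorizes.symm {f : Joint Val → ℝ} {A B : Finset X} (h : Factorizes f A B) :
    Factorizes f B A := fun w => by
  rw [Finset.union_comm, Finset.inter_comm, h w, mul_comm]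

/-- Sum the identity for `A`, `B` over the variables in `B \ B'`, which lie outside `A`: the factors
on `A` and `A ∩ B` come out of the sum, and the other two become marginals on `A ∪ B'` and `B'`. -/
theorem Factorizes.mono_right {f : Joint Val → ℝ} {A B B' : Finset X} (h : Factorizes f A B)
    (hB : B' ⊆ B) (hAB : A ∩ B ⊆ B') : Factorizes f A B' := by
  intro w
  set T : Finset X := A ∪ B' ∪ (A ∪ B)ᶜ with hT
  have e1 : T ∪ (A ∪ B) = Finset.univ := by ext x; simp [hT]; tauto
  have e3 : T ∩ (A ∪ B) = A ∪ B' := by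
    ext x; have := @hB x; simp [hT]; tauto
  have e5 : A ∩ B' = A ∩ B := by
    ext x; have := @hB x; have := @hAB x; simp at *; tauto
  -- The complement of `T'` is `B \ B'`, so `sumAgree · T'` sums out exactly these variables.
  set T' : Finset X := A ∪ Bᶜ ∪ B' with hT'
  have e2 : T' ∪ B = Finset.univ := by ext x; simp [hT']; tauto
  have e4 : T' ∩ B = B' := by
    ext x; have := @hB x; have := @hAB x; simp [hT'] at *; tauto
  have e6 : T' ∪ (A ∪ B) = Finset.univ := by ext x; simp [hT']; tauto
  have e7 : T' ∩ (A ∪ B) = A ∪ B' := by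
    ext x; have := @hB x; simp [hT']; tauto
  have key : sumAgree (fun v => sumAgree f (A ∩ B) v * sumAgree f (A ∪ B) v) T' w =
      sumAgree (fun v => sumAgree f A v * sumAgree f B v) T' w := by
    congr 1; funext v; rw [mul_comm, h v]
  rw [sumAgree_mul_left, sumAgree_mul_left, sumAgree_sumAgree f e6, sumAgree_sumAgree f e2, e4,
    e7] at key
  · rw [e5, mul_comm, key]
  · intro u v huv
    exact sumAgree_congr f _ fun x hx => huv x (by simp [hT', hx])
  · intro u v huv
    exact sumAgree_congr f _ fun x hx => huv x (by simp [hT', (Finset.mem_inter.1 hx).1])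

theorem Factorizes.mono {f : Joint Val → ℝ} {A B A' B' : Finset X} (h : Factorizes f A B)
    (hA : A' ⊆ A) (hB : B' ⊆ B) (hAB : A ∩ B ⊆ A' ∩ B') : Factorizes f A' B' :=
  ((h.mono_right hB (hAB.trans Finset.inter_subset_right)).symm.mono_right hA (by
    intro x hx
    rw [Finset.mem_inter] at hx
    exact (Finset.mem_inter.1 (hAB (Finset.mem_inter.2 ⟨hx.2, hB hx.1⟩))).1)).symm

/-- The conditional product of the marginals of `f` on `A` and `B`. -/
noncomputable def condProd (f : Joint Val → ℝ) (A B : Finset X) (w : Joint Val) : ℝ :=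
  sumAgree f A w / sumAgree f (A ∩ B) w * sumAgree f B w

theorem condProd_comm (f : Joint Val → ℝ) (A B : Finset X) :
    condProd f A B = condProd f B A := by
  funext w
  rw [condProd, condProd, Finset.inter_comm]
  ring

theorem condProd_nonneg {f : Joint Val → ℝ} (hf : ∀ v, 0 ≤ f v) (A B : Finset X)
    (w : Joint Val) : 0 ≤ condProd f A B w :=
  mul_nonneg (div_nonneg (sumAgree_nonneg hf _ _) (sumAgree_nonneg hf _ _))
    (sumAgree_nonneg hf _ _)

/-- The quotient depends only on `A`, and the factor on `B` sums to the marginal on `A ∩ B`, which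
cancels. Where that marginal is `0`, so is the one on `A`, by nonnegativity. -/
theorem sumAgree_condProd_left {f : Joint Val → ℝ} (hf : ∀ v, 0 ≤ f v) {A B : Finset X}
    (h : A ∪ B = Finset.univ) (w : Joint Val) :
    sumAgree (condProd f A B) A w = sumAgree f A w := by
  unfold condProd
  rw [sumAgree_mul_left, sumAgree_sumAgree f h]
  · refine div_mul_cancel_of_imp fun h0 => le_antisymm ?_ (sumAgree_nonneg hf _ _)
    exact h0 ▸ sumAgree_mono hf Finset.inter_subset_left w
  · intro u v huv
    rw [sumAgree_congr f A huv,
      sumAgree_congr f (A ∩ B) fun x hx => huv x (Finset.mem_inter.1 hx).1]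

theorem sumAgree_condProd_right {f : Joint Val → ℝ} (hf : ∀ v, 0 ≤ f v) {A B : Finset X}
    (h : A ∪ B = Finset.univ) (w : Joint Val) :
    sumAgree (condProd f A B) B w = sumAgree f B w := by
  rw [condProd_comm]
  exact sumAgree_condProd_left hf (by rwa [Finset.union_comm]) w

theorem sum_condProd [Nonempty (Joint Val)] {f : Joint Val → ℝ} (hf : ∀ v, 0 ≤ f v)
    {A B : Finset X} (h : A ∪ B = Finset.univ) : ∑ w, condProd f A B w = ∑ w, f w := by
  obtain ⟨w⟩ := ‹Nonempty (Joint Val)›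
  have hA : Aᶜ ∪ A = Finset.univ := by ext x; simp [em']
  have hA' : Aᶜ ∩ A = ∅ := by ext x; simp
  rw [← sumAgree_empty _ w, ← sumAgree_empty _ w, ← hA', ← sumAgree_sumAgree _ hA,
    ← sumAgree_sumAgree _ hA]
  congr 1
  exact funext (sumAgree_condProd_left hf h)

end JointSum

/-! ### Gibbs' inequality and the entropy of conditional products -/

/-- Gibbs' inequality, with its case of equality. -/
theorem eq_of_sum_mul_log_le {Ω : Type*} [Fintype Ω] {p q : Ω → ℝ} (hp : ∀ ω, 0 ≤ p ω)
    (hq : ∀ ω, 0 ≤ q ω) (hpq : ∀ ω, q ω = 0 → p ω = 0) (hsum : ∑ ω, p ω = ∑ ω, q ω)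
    (h : ∑ ω, p ω * Real.log (p ω) ≤ ∑ ω, p ω * Real.log (q ω)) : p = q := by
  -- Termwise this is `log x ≤ x - 1` at `x = q / p`, strict unless `x = 1`. The right-hand sides
  -- add up to `0`, so the assumed inequality forces equality in every term.
  have hpt : ∀ ω, p ω * Real.log (q ω) - p ω * Real.log (p ω) ≤ q ω - p ω ∧
      (p ω * Real.log (q ω) - p ω * Real.log (p ω) = q ω - p ω → p ω = q ω) := by
    intro ω
    rcases (hp ω).eq_or_lt with h0 | h0
    · simp only [← h0, zero_mul, sub_zero]
      exact ⟨hq ω, id⟩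
    · have hq0 : 0 < q ω := (hq ω).lt_of_ne fun h1 => h0.ne' (hpq ω h1.symm)
      have e : p ω * Real.log (q ω) - p ω * Real.log (p ω) = p ω * Real.log (q ω / p ω) := by
        rw [Real.log_div hq0.ne' h0.ne']; ring
      have e' : q ω - p ω = p ω * (q ω / p ω - 1) := by field_simp
      rw [e, e']
      refine ⟨mul_le_mul_of_nonneg_left (Real.log_le_sub_one_of_pos (div_pos hq0 h0)) h0.le,
        fun H => ?_⟩
      by_contra hne
      refine (Real.log_lt_sub_one_of_pos (div_pos hq0 h0) fun h1 => hne ?_).ne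
        (mul_left_cancel₀ h0.ne' H)
      exact ((div_eq_one_iff_eq h0.ne').1 h1).symm
  have hle := Finset.sum_le_sum fun ω (_ : ω ∈ Finset.univ) => (hpt ω).1
  have heq : ∑ ω, (p ω * Real.log (q ω) - p ω * Real.log (p ω)) = ∑ ω, (q ω - p ω) := by
    refine le_antisymm hle ?_
    rw [Finset.sum_sub_distrib, Finset.sum_sub_distrib]
    linarith
  rw [Finset.sum_eq_sum_iff_of_le fun ω _ => (hpt ω).1] at heq
  exact funext fun ω => (hpt ω).2 (heq ω (Finset.mem_univ ω))

open JointSum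

theorem stdSimplex.sum_map_mul {Ω Ω' : Type*} [Fintype Ω] [Fintype Ω'] (μ : stdSimplex ℝ Ω)
    (f : Ω → Ω') (g : Ω' → ℝ) :
    ∑ y, stdSimplex.map f μ y * g y = ∑ x, μ x * g (f x) := by
  classical
  simp only [stdSimplex.map_coe, FunOnFinite.linearMap_apply_apply]
  rw [← Finset.sum_fiberwise Finset.univ f]
  refine Finset.sum_congr rfl fun y _ => ?_
  rw [Finset.sum_mul]
  refine Finset.sum_congr rfl fun x hx => ?_
  rw [(Finset.mem_filter.1 hx).2]

section Marginals

variable {X : Type*} [Fintype X] [DecidableEq X] {Val : X → Type*} [∀ x, Fintype (Val x)]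

theorem marginal_restrict (μ : stdSimplex ℝ (Joint Val)) (S : Finset X) (w : Joint Val) :
    marginal μ S (S.restrict w) = sumAgree μ S w := by
  classical
  rw [marginal, stdSimplex.map_coe, FunOnFinite.linearMap_apply_apply, sumAgree,
    Finset.sum_filter]
  refine Finset.sum_congr rfl fun v _ => if_congr ?_ rfl rfl
  simp [funext_iff]

theorem nonempty_joint (μ : stdSimplex ℝ (Joint Val)) : Nonempty (Joint Val) := by
  by_contra hemp
  rw [not_nonempty_iff] at hemp
  simpa using stdSimplex.sum_eq_one μ

theorem marginal_eq_of_sumAgree_eq {μ q : stdSimplex ℝ (Joint Val)} {S : Finset X}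
    (h : ∀ w, sumAgree q S w = sumAgree μ S w) : marginal q S = marginal μ S := by
  obtain ⟨w₀⟩ := nonempty_joint μ
  refine DFunLike.ext _ _ fun s => ?_
  have hs : s = S.restrict (fun x => if hx : x ∈ S then s ⟨x, hx⟩ else w₀ x) := by
    funext x
    simp
  rw [hs, marginal_restrict, marginal_restrict, h]

theorem marginal_eq_map_marginal (μ : stdSimplex ℝ (Joint Val)) {S U : Finset X} (h : S ⊆ U) :
    marginal μ S = stdSimplex.map (Finset.restrict₂ h) (marginal μ U) := by
  rw [marginal, marginal, stdSimplex.map_comp_apply]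
  rfl

theorem pairMarginal_eq_map_marginal (μ : stdSimplex ℝ (Joint Val)) {T S U : Finset X}
    (hT : T ⊆ U) (hS : S ⊆ U) :
    pairMarginal μ T S =
      stdSimplex.map (fun w => (Finset.restrict₂ hT w, Finset.restrict₂ hS w)) (marginal μ U) := by
  rw [pairMarginal, marginal, stdSimplex.map_comp_apply]
  rfl

/-- Each side is the expectation of a function of the setting of `S`, so it depends on the marginal
alone. -/
theorem sum_mul_log_sumAgree {μ q : stdSimplex ℝ (Joint Val)} {S : Finset X}
    (h : marginal q S = marginal μ S) :
    ∑ w, q w * Real.log (sumAgree q S w) = ∑ w, μ w * Real.log (sumAgree μ S w) := by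
  have key : ∀ p : stdSimplex ℝ (Joint Val), ∑ w, p w * Real.log (sumAgree p S w) =
      ∑ s, marginal p S s * Real.log (marginal p S s) := by
    intro p
    simp only [← marginal_restrict]
    exact (stdSimplex.sum_map_mul p S.restrict fun s => Real.log (marginal p S s)).symm
  rw [key, key, h]

/-- The conditional product of two marginals of a distribution, as a distribution. -/
noncomputable def condProdDist (μ : stdSimplex ℝ (Joint Val)) (A B : Finset X)
    (h : A ∪ B = Finset.univ) : stdSimplex ℝ (Joint Val) :=
  ⟨condProd μ A B, condProd_nonneg (stdSimplex.zero_le μ) A B, by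
    have := nonempty_joint μ
    rw [sum_condProd (stdSimplex.zero_le μ) h, stdSimplex.sum_eq_one μ]⟩

theorem condProdDist_coe (μ : stdSimplex ℝ (Joint Val)) (A B : Finset X)
    (h : A ∪ B = Finset.univ) : ⇑(condProdDist μ A B h) = condProd μ A B := rfl

theorem marginal_condProdDist_left (μ : stdSimplex ℝ (Joint Val)) (A B : Finset X)
    (h : A ∪ B = Finset.univ) : marginal (condProdDist μ A B h) A = marginal μ A :=
  marginal_eq_of_sumAgree_eq (sumAgree_condProd_left (stdSimplex.zero_le μ) h)

theorem marginal_condProdDist_right (μ : stdSimplex ℝ (Joint Val)) (A B : Finset X)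
    (h : A ∪ B = Finset.univ) : marginal (condProdDist μ A B h) B = marginal μ B :=
  marginal_eq_of_sumAgree_eq (sumAgree_condProd_right (stdSimplex.zero_le μ) h)

theorem sumAgree_pos (μ : stdSimplex ℝ (Joint Val)) {w : Joint Val} (hw : μ w ≠ 0)
    (S : Finset X) : 0 < sumAgree μ S w := by
  refine ((stdSimplex.zero_le μ w).lt_of_ne hw.symm).trans_le ?_
  rw [← sumAgree_univ μ w]
  exact sumAgree_mono (stdSimplex.zero_le μ) (Finset.subset_univ S) w

theorem condProd_pos (μ : stdSimplex ℝ (Joint Val)) {w : Joint Val} (hw : μ w ≠ 0)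
    (A B : Finset X) : 0 < condProd μ A B w :=
  mul_pos (div_pos (sumAgree_pos μ hw _) (sumAgree_pos μ hw _)) (sumAgree_pos μ hw _)

theorem sumAgree_ne_zero_of_condProd_ne_zero {f : Joint Val → ℝ} {w : Joint Val} {A B : Finset X}
    (hw : condProd f A B w ≠ 0) :
    sumAgree f A w ≠ 0 ∧ sumAgree f (A ∩ B) w ≠ 0 ∧ sumAgree f B w ≠ 0 := by
  simpa [condProd, and_assoc] using hw

/-- The conditional product of two marginals of `μ` has the cross entropy of `μ` relative to it
as its entropy. -/
theorem sum_condProd_mul_log (μ : stdSimplex ℝ (Joint Val)) (A B : Finset X)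
    (h : A ∪ B = Finset.univ) :
    ∑ w, condProd μ A B w * Real.log (condProd μ A B w) =
      ∑ w, μ w * Real.log (condProd μ A B w) := by
  -- The logarithm splits into terms that each see only `A`, `A ∩ B` or `B`, where `μ` and the
  -- conditional product have equal marginals. Splitting needs nonzero factors, hence the support
  -- condition on `p`.
  have expand : ∀ p : Joint Val → ℝ, (∀ w, p w ≠ 0 → condProd μ A B w ≠ 0) →
      ∑ w, p w * Real.log (condProd μ A B w) =
        ∑ w, p w * Real.log (sumAgree μ A w) - ∑ w, p w * Real.log (sumAgree μ (A ∩ B) w) +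
          ∑ w, p w * Real.log (sumAgree μ B w) := by
    intro p hp
    rw [← Finset.sum_sub_distrib, ← Finset.sum_add_distrib]
    refine Finset.sum_congr rfl fun w _ => ?_
    by_cases hw : p w = 0
    · simp [hw]
    · obtain ⟨h1, h2, h3⟩ := sumAgree_ne_zero_of_condProd_ne_zero (hp w hw)
      rw [condProd, Real.log_mul (div_ne_zero h1 h2) h3, Real.log_div h1 h2]
      ring
  have hsum : ∀ S : Finset X, S ⊆ A ∨ S ⊆ B →
      ∑ w, condProd μ A B w * Real.log (sumAgree μ S w) =
        ∑ w, μ w * Real.log (sumAgree μ S w) := by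
    intro S hS
    have hm : marginal (condProdDist μ A B h) S = marginal μ S := by
      rcases hS with hS | hS
      · rw [marginal_eq_map_marginal _ hS, marginal_eq_map_marginal _ hS,
          marginal_condProdDist_left]
      · rw [marginal_eq_map_marginal _ hS, marginal_eq_map_marginal _ hS,
          marginal_condProdDist_right]
    rw [← sum_mul_log_sumAgree hm]
    simp only [← marginal_restrict, hm]
    rfl
  rw [expand _ fun _ => id, expand μ fun w hw => (condProd_pos μ hw A B).ne',
    hsum A (Or.inl subset_rfl), hsum B (Or.inr subset_rfl),
    hsum (A ∩ B) (Or.inl Finset.inter_subset_left)]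

/-- Among the distributions with given marginals on `A` and `B`, the conditional product of these
is the only one of the greatest entropy. -/
theorem eq_condProd_of_shannonEntropy_le (μ : stdSimplex ℝ (Joint Val)) (A B : Finset X)
    (h : A ∪ B = Finset.univ)
    (hle : shannonEntropy (condProdDist μ A B h) ≤ shannonEntropy μ) : ⇑μ = condProd μ A B := by
  have := nonempty_joint μ
  refine eq_of_sum_mul_log_le (stdSimplex.zero_le μ) (condProd_nonneg (stdSimplex.zero_le μ) A B)
    (fun w hw => by_contra fun h0 => (condProd_pos μ h0 A B).ne' hw)
    (sum_condProd (stdSimplex.zero_le μ) h).symm ?_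
  rw [← sum_condProd_mul_log μ A B h]
  simpa [shannonEntropy, Real.negMulLog, condProdDist_coe] using hle

theorem factorizes_of_eq_condProd {μ : stdSimplex ℝ (Joint Val)} {A B : Finset X}
    (h : A ∪ B = Finset.univ) (hμ : ⇑μ = condProd μ A B) : Factorizes μ A B := by
  intro w
  rw [h, sumAgree_univ]
  conv_lhs => rw [congrFun hμ w]
  rw [condProd, mul_right_comm]
  congr 1
  refine div_mul_cancel_of_imp fun h0 => le_antisymm ?_ (sumAgree_nonneg (stdSimplex.zero_le μ) _ _)
  exact h0 ▸ sumAgree_mono (stdSimplex.zero_le μ) Finset.inter_subset_left w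

end Marginals

/-! ### Minimizers of the score factorize -/

namespace PDG

variable {X : Type*} [Fintype X] [DecidableEq X] {Val : X → Type*} [∀ x, Fintype (Val x)]
  {A : Type*} [Fintype A]

/-- A minimizer of the scoring function, for `γ > 0`, factorizes over any two sets of variables
such that every hyperedge lies in one of them. -/
theorem factorizes_of_mem_semantics (M : PDG X Val A) {γ : ℝ≥0∞} (hγ : 0 < γ)
    (hfin_top : M.inconsistency γ ≠ ⊤) (hfin_bot : M.inconsistency γ ≠ ⊥)
    {μ : stdSimplex ℝ (Joint Val)} (hμ : μ ∈ M.semantics γ) {U V : Finset X}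
    (hUV : U ∪ V = Finset.univ) (hM : ∀ a, M.hyperedge a ⊆ U ∨ M.hyperedge a ⊆ V) :
    Factorizes μ U V := by
  refine factorizes_of_eq_condProd hUV (eq_condProd_of_shannonEntropy_le μ U V hUV ?_)
  set q := condProdDist μ U V hUV
  have hinc : M.inconsistency γ = M.score γ μ :=
    le_antisymm (iInf_le _ μ) (le_iInf hμ)
  have hmarg : ∀ a, marginal q (M.src a) = marginal μ (M.src a) ∧
      pairMarginal q (M.tgt a) (M.src a) = pairMarginal μ (M.tgt a) (M.src a) := by
    intro a
    have key : ∀ W : Finset X, M.hyperedge a ⊆ W → marginal q W = marginal μ W →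
        marginal q (M.src a) = marginal μ (M.src a) ∧
          pairMarginal q (M.tgt a) (M.src a) = pairMarginal μ (M.tgt a) (M.src a) := by
      intro W hW h
      have hs : M.src a ⊆ W := Finset.subset_union_left.trans hW
      have ht : M.tgt a ⊆ W := Finset.subset_union_right.trans hW
      rw [marginal_eq_map_marginal q hs, marginal_eq_map_marginal μ hs,
        pairMarginal_eq_map_marginal q ht hs, pairMarginal_eq_map_marginal μ ht hs, h]
      exact ⟨rfl, rfl⟩
    rcases hM a with h | h
    · exact key U h (marginal_condProdDist_left μ U V hUV)
    · exact key V h (marginal_condProdDist_right μ U V hUV)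
  have hO : M.oInc q = M.oInc μ := by
    simp only [oInc, (hmarg _).1, (hmarg _).2]
  have hS : M.sInc q = M.sInc μ + shannonEntropy μ - shannonEntropy q := by
    simp only [sInc, condEntropy, (hmarg _).1, (hmarg _).2]
    ring
  have hle : M.sInc μ ≤ M.sInc q := by
    have hscore := hμ q
    rw [hinc] at hfin_top hfin_bot
    unfold score at hscore hfin_top hfin_bot
    split_ifs at hscore hfin_top hfin_bot with hγ'
    · exact EReal.coe_le_coe_iff.1 hscore
    · rw [hO] at hscore
      have hpos : 0 < γ.toReal := ENNReal.toReal_pos hγ.ne' hγ'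
      -- The common `OInc` can be cancelled only if it is finite, which is what finiteness of the
      -- inconsistency, the score of `μ`, provides.
      generalize M.oInc μ = o at hscore hfin_top hfin_bot
      induction o with
      | bot => simp at hfin_bot
      | top => exact absurd (EReal.top_add_coe _) hfin_top
      | coe r =>
        rw [← EReal.coe_add, ← EReal.coe_add, EReal.coe_le_coe_iff] at hscore
        exact le_of_mul_le_mul_left (by linarith) hpos
  linarith

end PDG

/-! ### Cutting a tree decomposition at an edge -/

section TreeDecomposition

variable {X A : Type*} [Fintype X] [DecidableEq X] {E : A → Finset X} {𝒞 : Finset (Finset X)}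
  {𝒯 : SimpleGraph 𝒞}

/-- An edge of the tree of a tree decomposition splits the set of variables into two sets, such
that each cluster lies in one of them, and their intersection is the separator of the edge. -/
theorem IsTreeDecomposition.exists_cut (hT : IsTreeDecomposition E 𝒞 𝒯) {C D : 𝒞}
    (h : 𝒯.Adj C D) :
    ∃ U V : Finset X, U ∪ V = Finset.univ ∧ (∀ a, E a ⊆ U ∨ E a ⊆ V) ∧
      U ∩ V ⊆ (C : Finset X) ∩ D ∧ (D : Finset X) ⊆ V ∧
      ∀ B : 𝒞, (𝒯.deleteEdges {s(C, D)}).Reachable C B → (B : Finset X) ⊆ U := by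
  classical
  -- `R` is the side of `C` once the edge is removed; `D` is on the other side because every edge of
  -- a tree is a bridge. `U` and `V` are the unions of the clusters on the two sides.
  set R : 𝒞 → Prop := fun B => (𝒯.deleteEdges {s(C, D)}).Reachable C B with hR
  have hD : ¬ R D := (SimpleGraph.isAcyclic_iff_forall_adj_isBridge.1 hT.isTree.isAcyclic) h
  refine ⟨Finset.univ.filter fun x => ∃ B : 𝒞, R B ∧ x ∈ (B : Finset X),
    Finset.univ.filter fun x => ∃ B : 𝒞, ¬ R B ∧ x ∈ (B : Finset X), ?_, ?_, ?_, ?_, ?_⟩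
  · ext x
    obtain ⟨B, hB, hx⟩ := hT.vertex_mem x
    by_cases hRB : R ⟨B, hB⟩
    · exact iff_of_true (Finset.mem_union_left _ (Finset.mem_filter.2
        ⟨Finset.mem_univ x, ⟨B, hB⟩, hRB, hx⟩)) (Finset.mem_univ x)
    · exact iff_of_true (Finset.mem_union_right _ (Finset.mem_filter.2
        ⟨Finset.mem_univ x, ⟨B, hB⟩, hRB, hx⟩)) (Finset.mem_univ x)
  · intro a
    obtain ⟨B, hB, ha⟩ := hT.hyperedge_subset a
    by_cases hRB : R ⟨B, hB⟩
    · exact Or.inl fun x hx => Finset.mem_filter.2 ⟨Finset.mem_univ x, ⟨B, hB⟩, hRB, ha hx⟩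
    · exact Or.inr fun x hx => Finset.mem_filter.2 ⟨Finset.mem_univ x, ⟨B, hB⟩, hRB, ha hx⟩
  · intro x hx
    obtain ⟨hx1, hx2⟩ := Finset.mem_inter.1 hx
    obtain ⟨B₁, hB₁, hx1⟩ := (Finset.mem_filter.1 hx1).2
    obtain ⟨B₂, hB₂, hx2⟩ := (Finset.mem_filter.1 hx2).2
    -- A path between clusters on opposite sides uses the edge, so the running intersection property
    -- puts `x` into both of its endpoints.
    obtain ⟨p, hp⟩ := hT.isTree.connected.exists_isPath B₁ B₂
    have hedge : s(C, D) ∈ p.edges := by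
      by_contra hne
      exact hB₂ (hB₁.trans (SimpleGraph.reachable_deleteEdges_iff_exists_walk.2 ⟨p, hne⟩))
    have hsub := hT.inter_subset B₁ B₂ p hp
    have hx12 := Finset.mem_inter.2 ⟨hx1, hx2⟩
    exact Finset.mem_inter.2 ⟨hsub C (p.fst_mem_support_of_mem_edges hedge) hx12,
      hsub D (p.snd_mem_support_of_mem_edges hedge) hx12⟩
  · exact fun x hx => Finset.mem_filter.2 ⟨Finset.mem_univ x, D, hD, hx⟩
  · exact fun B hB x hx => Finset.mem_filter.2 ⟨Finset.mem_univ x, B, hB, hx⟩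

end TreeDecomposition

/-! ### Growing a tree by leaves -/

section Trees

variable {V : Type*} {G : SimpleGraph V}

/-- `S` contains with every vertex a walk to it from the vertex `r`. -/
def IsConnectedFrom (G : SimpleGraph V) (r : V) (S : Finset V) : Prop :=
  ∀ v ∈ S, ∃ p : G.Walk r v, ∀ u ∈ p.support, u ∈ S

/-- The walk from `c` to `v` through `r` stays in `S`, so it never meets `d`. -/
theorem IsConnectedFrom.reachable_deleteEdges {r : V} {S : Finset V} (hS : IsConnectedFrom G r S)
    {c d v : V} (hc : c ∈ S) (hd : d ∉ S) (hv : v ∈ S) :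
    (G.deleteEdges {s(c, d)}).Reachable c v := by
  obtain ⟨p, hp⟩ := hS c hc
  obtain ⟨q, hq⟩ := hS v hv
  refine SimpleGraph.reachable_deleteEdges_iff_exists_walk.2 ⟨p.reverse.append q, fun he => hd ?_⟩
  have := (p.reverse.append q).snd_mem_support_of_mem_edges he
  rw [SimpleGraph.Walk.mem_support_append_iff, SimpleGraph.Walk.support_reverse,
    List.mem_reverse] at this
  exact this.elim (hp d) (hq d)

theorem IsConnectedFrom.cons [DecidableEq V] {r : V} {S : Finset V} (hS : IsConnectedFrom G r S)
    {c d : V} (hc : c ∈ S) (h : G.Adj c d) : IsConnectedFrom G r (insert d S) := by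
  intro v hv
  rcases Finset.mem_insert.1 hv with rfl | hv
  · obtain ⟨p, hp⟩ := hS c hc
    refine ⟨p.concat h, fun u hu => ?_⟩
    rw [SimpleGraph.Walk.support_concat, List.mem_append, List.mem_singleton] at hu
    exact Finset.mem_insert.2 (hu.elim (fun hu => Or.inr (hp u hu)) Or.inl)
  · obtain ⟨p, hp⟩ := hS v hv
    exact ⟨p, fun u hu => Finset.mem_insert_of_mem (hp u hu)⟩

/-- In an acyclic graph, a vertex outside of a connected set has at most one neighbour in it. -/
theorem IsConnectedFrom.eq_of_adj {r : V} {S : Finset V} (hS : IsConnectedFrom G r S)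
    (hG : G.IsAcyclic) {c c' d : V} (hc : c ∈ S) (hc' : c' ∈ S) (hd : d ∉ S)
    (h : G.Adj c d) (h' : G.Adj c' d) : c' = c := by
  by_contra hne
  -- A second neighbour `c'` would give a route from `c` through `S` to `c'` and on to `d` avoiding
  -- the edge `c - d`, which is a bridge.
  refine (SimpleGraph.isAcyclic_iff_forall_adj_isBridge.1 hG h)
    ((hS.reachable_deleteEdges hc hd hc').trans (SimpleGraph.Adj.reachable ?_))
  rw [SimpleGraph.deleteEdges_adj]
  refine ⟨h', fun he => ?_⟩
  rcases Sym2.eq_iff.1 (Set.mem_singleton_iff.1 he) with ⟨h1, _⟩ | ⟨h1, _⟩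
  · exact hne h1
  · exact hd (h1 ▸ hc')

/-- Induction on a finite tree: adding one leaf at a time, starting from a single vertex. -/
theorem SimpleGraph.IsTree.induction_add_leaf [Fintype V] [DecidableEq V] (hG : G.IsTree)
    (P : Finset V → Prop) (single : ∀ r, P {r})
    (step : ∀ (r : V) (S : Finset V), IsConnectedFrom G r S → P S →
      ∀ c ∈ S, ∀ d ∉ S, G.Adj c d → P (insert d S)) : P Finset.univ := by
  obtain ⟨r⟩ := hG.connected.nonempty
  have key : ∀ n : ℕ, n < Fintype.card V →
      ∃ S : Finset V, S.card = n + 1 ∧ r ∈ S ∧ IsConnectedFrom G r S ∧ P S := by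
    intro n
    induction n with
    | zero =>
      refine fun _ => ⟨{r}, by simp, by simp, fun v hv => ?_, single r⟩
      obtain rfl := Finset.mem_singleton.1 hv
      exact ⟨.nil, by simp⟩
    | succ n ih =>
      intro hn
      obtain ⟨S, hcard, hr, hS, hP⟩ := ih (by omega)
      obtain ⟨v, hv⟩ : ∃ v, v ∉ S := by
        by_contra! hall
        rw [Finset.eq_univ_iff_forall.2 hall, Finset.card_univ] at hcard
        omega
      obtain ⟨p⟩ := hG.connected r v
      obtain ⟨e, _, h1, h2⟩ := p.exists_boundary_dart (S : Set V) hr hv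
      have h2' : e.snd ∉ S := h2
      refine ⟨insert e.snd S, by rw [Finset.card_insert_of_notMem h2', hcard],
        Finset.mem_insert_of_mem hr, hS.cons h1 e.adj, step r S hS hP e.fst h1 e.snd h2' e.adj⟩
  have hpos : 0 < Fintype.card V := Fintype.card_pos_iff.2 ⟨r⟩
  obtain ⟨S, hcard, -, -, hP⟩ := key (Fintype.card V - 1) (by omega)
  rwa [← (Finset.card_eq_iff_eq_univ S).1 (by omega)]

theorem filter_edgeFinset_insert [Fintype V] [DecidableEq V] [DecidableRel G.Adj] {r : V}
    {S : Finset V} (hS : IsConnectedFrom G r S) (hG : G.IsAcyclic) {c d : V} (hc : c ∈ S)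
    (hd : d ∉ S) (h : G.Adj c d) :
    (G.edgeFinset.filter fun e => ∀ v ∈ e, v ∈ insert d S) =
      insert s(c, d) (G.edgeFinset.filter fun e => ∀ v ∈ e, v ∈ S) := by
  ext e
  induction e with | _ a b
  simp only [Finset.mem_filter, SimpleGraph.mem_edgeFinset, SimpleGraph.mem_edgeSet, Sym2.mem_iff,
    forall_eq_or_imp, forall_eq, Finset.mem_insert, Sym2.eq_iff]
  constructor
  · rintro ⟨hab, rfl | ha, rfl | hb⟩
    · exact absurd hab (G.loopless.irrefl _)
    · exact Or.inl (Or.inr ⟨rfl, hS.eq_of_adj hG hc hb hd h hab.symm⟩)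
    · exact Or.inl (Or.inl ⟨hS.eq_of_adj hG hc ha hd h hab, rfl⟩)
    · exact Or.inr ⟨hab, ha, hb⟩
  · rintro ((⟨rfl, rfl⟩ | ⟨rfl, rfl⟩) | ⟨hab, ha, hb⟩)
    · exact ⟨h, Or.inr hc, Or.inl rfl⟩
    · exact ⟨h.symm, Or.inl rfl, Or.inr hc⟩
    · exact ⟨hab, Or.inr ha, Or.inr hb⟩

end Trees

/-! ### The product formula for the marginal clique tree -/

section CliqueTrees

variable {X : Type*} [Fintype X] [DecidableEq X] {Val : X → Type*} [∀ x, Fintype (Val x)]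
  {A : Type*} {E : A → Finset X} {𝒞 : Finset (Finset X)} {𝒯 : SimpleGraph 𝒞}

/-- The clique tree of the marginals of a joint distribution. -/
noncomputable def marginalCliqueTree (𝒞 : Finset (Finset X)) (μ : stdSimplex ℝ (Joint Val)) :
    CliqueTree Val 𝒞 :=
  fun C => marginal μ C

theorem clusterMarginal_marginalCliqueTree (μ : stdSimplex ℝ (Joint Val)) (C : 𝒞) (S : Finset X)
    (h : S ⊆ (C : Finset X)) :
    (marginalCliqueTree 𝒞 μ).clusterMarginal C S h = marginal μ S :=
  (marginal_eq_map_marginal μ h).symm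

theorem isCalibrated_marginalCliqueTree (μ : stdSimplex ℝ (Joint Val)) (𝒯 : SimpleGraph 𝒞) :
    (marginalCliqueTree 𝒞 μ).IsCalibrated 𝒯 := fun C D _ => by
  rw [clusterMarginal_marginalCliqueTree, clusterMarginal_marginalCliqueTree]

theorem sepProb_marginalCliqueTree (μ : stdSimplex ℝ (Joint Val)) (C D : 𝒞) (w : Joint Val) :
    (marginalCliqueTree 𝒞 μ).sepProb C D w = sumAgree μ ((C : Finset X) ∩ D) w := by
  rw [CliqueTree.sepProb, clusterMarginal_marginalCliqueTree, marginal_restrict]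

/-- A distribution that factorizes over every two sets of variables that cover the hyperedges is
the distribution of the clique tree of its marginals. -/
theorem IsTreeDecomposition.pr_marginalCliqueTree [DecidableRel 𝒯.Adj]
    (hT : IsTreeDecomposition E 𝒞 𝒯) {μ : stdSimplex ℝ (Joint Val)}
    (hμ : ∀ U V : Finset X, U ∪ V = Finset.univ → (∀ a, E a ⊆ U ∨ E a ⊆ V) → Factorizes μ U V)
    (w : Joint Val) : (marginalCliqueTree 𝒞 μ).pr 𝒯 w = μ w := by
  have hcal := isCalibrated_marginalCliqueTree μ 𝒯
  -- The product formula is proved without division, for the union of the clusters in a connected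
  -- set `S` and the tree edges inside `S`.
  have key : sumAgree μ ((Finset.univ : Finset 𝒞).biUnion fun C => C) w *
      ∏ e ∈ 𝒯.edgeFinset.filter (fun e => ∀ C ∈ e, C ∈ (Finset.univ : Finset 𝒞)),
        (marginalCliqueTree 𝒞 μ).sepFactor e w =
      ∏ C ∈ (Finset.univ : Finset 𝒞), sumAgree μ C w := by
    refine hT.isTree.induction_add_leaf (fun S => sumAgree μ (S.biUnion fun C => C) w *
      ∏ e ∈ 𝒯.edgeFinset.filter (fun e => ∀ C ∈ e, C ∈ S),
        (marginalCliqueTree 𝒞 μ).sepFactor e w = ∏ C ∈ S, sumAgree μ C w) ?_ ?_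
    · intro C
      have hemp : (𝒯.edgeFinset.filter fun e => ∀ D ∈ e, D ∈ ({C} : Finset 𝒞)) = ∅ := by
        refine Finset.filter_eq_empty_iff.2 fun e => ?_
        induction e with | _ a b
        intro he hab
        rw [SimpleGraph.mem_edgeFinset, SimpleGraph.mem_edgeSet] at he
        have ha := Finset.mem_singleton.1 (hab a (Sym2.mem_mk_left a b))
        have hb := Finset.mem_singleton.1 (hab b (Sym2.mem_mk_right a b))
        exact he.ne (ha.trans hb.symm)
      rw [hemp]
      simp
    · intro r S hS ih C hC D hD hCD
      obtain ⟨U, V, hUV, hE, hsep, hDV, hU⟩ := hT.exists_cut hCD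
      have hSU : (S.biUnion fun C => (C : Finset X)) ⊆ U :=
        Finset.biUnion_subset.2 fun B hB => hU B (hS.reachable_deleteEdges hC hD hB)
      have hCS : (C : Finset X) ⊆ S.biUnion fun C => (C : Finset X) :=
        Finset.subset_biUnion_of_mem (fun C : 𝒞 => (C : Finset X)) hC
      -- The new cluster `D` meets the variables already covered exactly in the separator `C ∩ D`:
      -- at most by the cut, at least because `C ∈ S`.
      have hinter : (S.biUnion fun C => (C : Finset X)) ∩ D = (C : Finset X) ∩ D :=
        ((Finset.inter_subset_inter hSU hDV).trans hsep).antisymm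
          (Finset.inter_subset_inter_right hCS)
      have hfac : Factorizes μ (S.biUnion fun C => (C : Finset X)) D :=
        (hμ U V hUV hE).mono hSU hDV (hinter.symm ▸ hsep)
      have hfac := hfac w
      rw [hinter, Finset.union_comm] at hfac
      have hnot : s(C, D) ∉ 𝒯.edgeFinset.filter (fun e => ∀ B ∈ e, B ∈ S) := fun he =>
        hD ((Finset.mem_filter.1 he).2 D (Sym2.mem_mk_right C D))
      rw [filter_edgeFinset_insert hS hT.isTree.isAcyclic hC hD hCD, Finset.prod_insert hnot,
        Finset.prod_insert hD, Finset.biUnion_insert, CliqueTree.sepFactor_mk hcal hCD,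
        sepProb_marginalCliqueTree, ← ih, ← mul_assoc, hfac]
      ring
  have huniv : ((Finset.univ : Finset 𝒞).biUnion fun C => (C : Finset X)) = Finset.univ := by
    refine Finset.eq_univ_iff_forall.2 fun x => Finset.mem_biUnion.2 ?_
    obtain ⟨C, hC, hx⟩ := hT.vertex_mem x
    exact ⟨⟨C, hC⟩, Finset.mem_univ _, hx⟩
  rw [huniv, sumAgree_univ, Finset.filter_true_of_mem fun e _ C _ => Finset.mem_univ C] at key
  have hnum : ∏ C : 𝒞, marginalCliqueTree 𝒞 μ C ((C : Finset X).restrict w) =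
      ∏ C : 𝒞, sumAgree μ C w :=
    Finset.prod_congr rfl fun C _ => marginal_restrict μ C w
  rw [CliqueTree.pr, hnum, ← key]
  -- If a separator has probability `0` at `w`, then `μ w = 0`, in agreement with `0 / 0 = 0`.
  refine mul_div_cancel_of_imp fun h0 => ?_
  obtain ⟨e, _, he0⟩ := Finset.prod_eq_zero_iff.1 h0
  by_contra hw
  refine (sumAgree_pos μ hw ((e.out.1 : Finset X) ∩ e.out.2)).ne' ?_
  rw [← sepProb_marginalCliqueTree]
  exact he0

end CliqueTrees

theorem mainTheorem4 {X : Type*} [Fintype X] [DecidableEq X] {Val : X → Type*}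
    [∀ x, Fintype (Val x)] {A : Type*} [Fintype A] (M : PDG X Val A)
    (𝒞 : Finset (Finset X)) (𝒯 : SimpleGraph 𝒞) [DecidableRel 𝒯.Adj]
    (hT : IsTreeDecomposition M.hyperedge 𝒞 𝒯)
    (γ : ℝ≥0∞) (hγ : 0 < γ)
    (hfin_top : M.inconsistency γ ≠ ⊤) (hfin_bot : M.inconsistency γ ≠ ⊥)
    (μ : stdSimplex ℝ (Joint Val)) (hμ : μ ∈ M.semantics γ) :
    ∃ ν : CliqueTree Val 𝒞, ν.IsCalibrated 𝒯 ∧ ∀ w, ν.pr 𝒯 w = μ w :=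
  ⟨marginalCliqueTree 𝒞 μ, isCalibrated_marginalCliqueTree μ 𝒯,
    hT.pr_marginalCliqueTree fun _ _ hUV hE =>
      M.factorizes_of_mem_semantics hγ hfin_top hfin_bot hμ hUV hE⟩
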